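/- Let $n\ge 1$ be an integer and let $V$ be a real vector space, possibly infinite-dimensional, with $\dim V\ge n$. An $n$-inner product on $V$ is a function $(a_1,\dots,a_n,b_1,\dots,b_n)\mapsto\langle a_1,\dots,a_n\mid b_1,\dots,b_n\rangle\in\mathbb R$ on $V^{2n}$ such that for all vectors and scalars: (i) $\langle a_1,\dots,a_n\mid a_1,\dots,a_n\rangle>0$ if $a_1,\dots,a_n$ are linearly independent; (ii) $\langle a_1,\dots,a_n\mid b_1,\dots,b_n\rangle=\langle b_1,\dots,b_n\mid a_1,\dots,a_n\rangle$; (iii) $\langle \lambda a_1,a_2,\dots,a_n\mid b_1,\dots,b_n\rangle=\lambda\langle a_1,\dots,a_n\mid b_1,\dots,b_n\rangle$; (iv) $\langle a_1,\dots,a_n\mid b_1,\dots,b_n\rangle=-\langle a_{\sigma(1)},\dots,a_{\sigma(n)}\mid b_1,\dots,b_n\rangle$ for every odd permutation $\sigma$; (v) $\langle a_1+c,a_2,\dots,a_n\mid b_1,\dots,b_n\rangle=\langle a_1,\dots,a_n\mid b_1,\dots,b_n\rangle+\langle c,a_2,\dots,a_n\mid b_1,\dots,b_n\rangle$; (vi)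 if $\langle a_1,b_1,\dots,b_{i-1},b_{i+1},\dots,b_n\mid b_1,\dots,b_n\rangle=0$ for every $i\in\{1,\dots,n\}$, then $\langle a_1,a_2,\dots,a_n\mid b_1,\dots,b_n\rangle=0$ for all $a_2,\dots,a_n$. Write $\|a_1,\dots,a_n\|=\sqrt{\langle a_1,\dots,a_n\mid a_1,\dots,a_n\rangle}$, let $\Lambda_n(V)$ be the $n$-th exterior power of $V$, and let $G_n(V)$ be the set of $n$-dimensional linear subspaces of $V$. Then for every $n$-inner product on $V$: (1) There is an inner product $\langle\cdot\mid\cdot\rangle$ on $\Lambda_n(V)$ with $\langle a_1\wedge\cdots\wedge a_n\mid b_1\wedge\cdots\wedge b_n\rangle=\langle a_1,\dots,a_n\mid b_1,\dots,b_n\rangle$ for all $a_i,b_j\in V$. For every basis $(e_\alpha)$ of $V$ it is the one and only function on $\Lambda_n(V)\times\Lambda_n(V)$ that satisfies $$\Big\langle \sum_{I}p_{I}\,e_{i_1}\wedge\cdots\wedge e_{i_n}\,\Big|\,\sum_{J}q_{J}\,e_{j_1}\wedge\cdots\wedge e_{j_n}\Big\rangle=\sum_{I,J}p_{I}q_{J}\,\langle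 e_{i_1},\dots,e_{i_n}\mid e_{j_1},\dots,e_{j_n}\rangle$$ for all finitely supported real families $(p_I),(q_J)$ indexed by all $n$-tuples $I=(i_1,\dots,i_n)$, $J=(j_1,\dots,j_n)$ of basis indices. In particular this bilinear extension is well defined and independent of the basis. (2) There is a metric $d$ on $G_n(V)$ such that $$d(\Sigma_1,\Sigma_2)=\arccos\frac{|\langle a_1,\dots,a_n\mid b_1,\dots,b_n\rangle|}{\|a_1,\dots,a_n\|\,\|b_1,\dots,b_n\|}$$ for all $\Sigma_1,\Sigma_2\in G_n(V)$, all linearly independent $a_1,\dots,a_n\in\Sigma_1$ and all linearly independent $b_1,\dots,b_n\in\Sigma_2$; in particular the right-hand side does not depend on the chosen bases. (3) If $V$ is finite-dimensional, the topology of $d$ is the usual topology of the Grassmannian $G_n(V)$, that is, the quotient topology from the space of linearly independent $n$-tuples in $V^n$. For arbitrary $V$ and every finite-dimensional subspace $W\subseteq V$, the topology that $d$ induces on $G_n(W)\subseteq G_n(V)$ is the usual topology of $G_n(W)$. -/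

import Mathlib

/-- The tuple `(x, b₁, …, bᵢ₋₁, bᵢ₊₁, …, bₙ)`: drop `bᵢ` from `b` and put `x` in front. -/
def dropPrepend {n : ℕ} [NeZero n] {V : Type*} (x : V) (b : Fin n → V) (i : Fin n) :
    Fin n → V :=
  fun j => if j = 0 then x else if j ≤ i then b (j - 1) else b j

/-- An `n`-inner product (`n ≥ 1`) on a real vector space `V`: a real function on `V^{2n}`,
written `⟨a₁, …, aₙ | b₁, …, bₙ⟩`. The first vector `a₁` is `a 0`. -/
structure NInnerProduct (n : ℕ) [NeZero n] (V : Type*) [AddCommGroup V] [Module ℝ V] where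
  toFun : (Fin n → V) → (Fin n → V) → ℝ
  pos : ∀ a : Fin n → V, LinearIndependent ℝ a → 0 < toFun a a
  symm : ∀ a b : Fin n → V, toFun a b = toFun b a
  smul_first : ∀ (r : ℝ) (a b : Fin n → V),
    toFun (Function.update a 0 (r • a 0)) b = r * toFun a b
  odd_perm : ∀ (σ : Equiv.Perm (Fin n)) (a b : Fin n → V), Equiv.Perm.sign σ = -1 →
    toFun a b = -toFun (fun i => a (σ i)) b
  add_first : ∀ (a b : Fin n → V) (c : V),
    toFun (Function.update a 0 (a 0 + c)) b = toFun a b + toFun (Function.update a 0 c) b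
  orthogonal : ∀ a b : Fin n → V,
    (∀ i : Fin n, toFun (dropPrepend (a 0) b i) b = 0) → toFun a b = 0

namespace NInnerProduct

variable {n : ℕ} [NeZero n] {V : Type*} [AddCommGroup V] [Module ℝ V]

instance : CoeFun (NInnerProduct n V) (fun _ => (Fin n → V) → (Fin n → V) → ℝ) :=
  ⟨NInnerProduct.toFun⟩

/-- The induced `n`-norm `‖a₁, …, aₙ‖`. -/
noncomputable def nnorm (N : NInnerProduct n V) (a : Fin n → V) : ℝ := Real.sqrt (N a a)

/-- The `n`-form `∑ p_{i₁ … iₙ} e_{i₁} ∧ … ∧ e_{iₙ}` with finitely many nonzero coefficients;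
the sum runs over all index tuples. -/
noncomputable def wedgeSum {ι : Type*} (e : Module.Basis ι ℝ V) (p : (Fin n → ι) →₀ ℝ) :
    ⋀[ℝ]^n V :=
  p.sum fun I c => c • exteriorPower.ιMulti ℝ n (fun k => e (I k))

/-- `f` is the bilinear extension of the `n`-inner product from the wedges of the vectors of
the basis `e`. -/
def IsExtensionFromBasis (N : NInnerProduct n V) {ι : Type*} (e : Module.Basis ι ℝ V)
    (f : ⋀[ℝ]^n V → ⋀[ℝ]^n V → ℝ) : Prop :=
  ∀ p q : (Fin n → ι) →₀ ℝ,
    f (wedgeSum e p) (wedgeSum e q) =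
      p.sum fun I c => q.sum fun J d => c * d * N (fun k => e (I k)) (fun k => e (J k))

end NInnerProduct

/-- The Grassmannian `G_n(V)` of `n`-dimensional subspaces of `V` (used for `n ≥ 1` only, where
`finrank = n` entails finite dimension). -/
@[ext]
structure Grassmann (n : ℕ) (V : Type*) [AddCommGroup V] [Module ℝ V] where
  toSubmodule : Submodule ℝ V
  finrank_eq : Module.finrank ℝ toSubmodule = n

namespace Grassmann

variable {n : ℕ} {V : Type*} [AddCommGroup V] [Module ℝ V]

/-- The subspace spanned by an `n`-frame, that is by `n` linearly independent vectors. -/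
def ofFrame (a : {a : Fin n → V // LinearIndependent ℝ a}) : Grassmann n V :=
  ⟨Submodule.span ℝ (Set.range a.1), by
    simpa using finrank_span_eq_card a.2⟩

variable (n V) in
/-- The usual topology of `G_n(V)`: the quotient topology from the space of `n`-frames, a
subspace of `V^n`. Here `V` carries its module topology, which for finite-dimensional `V` is the
usual one. -/
abbrev usualTopology : TopologicalSpace (Grassmann n V) :=
  letI : TopologicalSpace V := moduleTopology ℝ V
  TopologicalSpace.coinduced (ofFrame (n := n) (V := V)) inferInstance

/-- The inclusion `G_n(W) → G_n(V)` for a subspace `W` of `V`. -/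
def ofSubspace (W : Submodule ℝ V) (S : Grassmann n W) : Grassmann n V :=
  ⟨S.toSubmodule.map W.subtype,
    (Submodule.equivMapOfInjective W.subtype W.injective_subtype
      S.toSubmodule).finrank_eq.symm.trans S.finrank_eq⟩

end Grassmann

/-! Multilinearity and symmetry alone give a symmetric bilinear form `bilin` on the exterior power;
the substance of (1) is its positivity, since (i) only controls decomposable vectors. Positivity
follows once every finite-dimensional subspace lies in the span of an independent family `e` whose
wedges are mutually orthogonal: the form is then a sum of squares with positive weights
(`bilin_self_pos`).

Axiom (vi) makes such a family possible. For an independent tuple `b` it gives V = `rad b` ⊕ span b,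
where `rad b` consists of the vectors annihilated by ⟨· | b⟩ in every slot, so every vector has
coefficients along `b`. The family is needed with e_j in `rad (e ∘ J)` whenever j is not in J. It is
easy to arrange this modulo the n-1 vectors a₂, …, aₙ, for tuples J containing them, by
diagonalising one ordinary bilinear form (`exists_isOrthoAbove`). These exceptional vectors are then
removed one at a time: the coefficient of e_j along an exceptional e_s does not depend on J
(`coeff_eq_of_isOrthoAbove`), so a single shear e_j + t_j e_s cancels it for all J together.

For (2), d is the angle between lines of the resulting Euclidean space, and a wedge determines its
subspace. For (3), the usual Grassmannian of a finite-dimensional space is compact, and it maps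
continuously and injectively to the metric one. -/

namespace NInnerProduct

/-! ### The forms ⟨· | b⟩, their radicals and coefficients along b. -/

theorem update_swap_comp {n : ℕ} [NeZero n] {V : Type*} (a : Fin n → V) (i : Fin n)
    (x : V) :
    (fun j => Function.update a i x (Equiv.swap 0 i j)) =
      Function.update (fun j => a (Equiv.swap 0 i j)) 0 x := by
  have := Function.update_comp_equiv a (Equiv.swap 0 i) i x
  simpa [Function.comp_def] using this

/-- Moving x from position i to the front is a cycle, so up to sign the hypothesis of axiom (vi)
says that the slots of b filled with x vanish. -/
theorem dropPrepend_eq_comp {n : ℕ} [NeZero n] {V : Type*} (x : V) (b : Fin n → V)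
    (i : Fin n) :
    dropPrepend x b i = Function.update b i x ∘ i.cycleRange.symm := by
  obtain ⟨m, rfl⟩ := Nat.exists_eq_succ_of_ne_zero (NeZero.ne n)
  have h : Function.update b i x = i.insertNth x (i.removeNth b) := by simp
  rw [h]
  rw [Fin.insertNth_comp_cycleRange_symm]
  funext j
  refine Fin.cases ?_ (fun k => ?_) j
  · simp [dropPrepend]
  · have hk : k.succ - 1 = k.castSucc := by
      ext
      rw [Fin.val_sub_one_of_ne_zero (Fin.succ_ne_zero k)]
      simp
    simp only [dropPrepend, Fin.succ_ne_zero, if_false, Fin.cons_succ, Fin.removeNth, hk]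
    split_ifs with h1
    · rw [Fin.succAbove_of_castSucc_lt _ _ (lt_of_lt_of_le Fin.castSucc_lt_succ h1)]
    · rw [Fin.succAbove_of_lt_succ _ _ (not_le.mp h1)]

variable {n : ℕ} [NeZero n] {V : Type*} [AddCommGroup V] [Module ℝ V] (N : NInnerProduct n V)

theorem apply_eq_neg_swap (a b : Fin n → V) {i j : Fin n} (hij : i ≠ j) :
    N a b = -N (fun k => a (Equiv.swap i j k)) b :=
  N.odd_perm _ a b (Equiv.Perm.sign_swap hij)

/-- The alternating form `a ↦ ⟨a | b⟩`. -/
def form (b : Fin n → V) : V [⋀^Fin n]→ₗ[ℝ] ℝ :=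
  { MultilinearMap.mk' (fun a => N a b)
      (by
        intro a i x y
        rcases eq_or_ne i 0 with rfl | hi
        · have := N.add_first (Function.update a 0 x) b y
          simpa using this
        · have h (z : V) := N.apply_eq_neg_swap (Function.update a i z) b hi.symm
          rw [h, h x, h y]
          simp only [update_swap_comp]
          have := N.add_first (Function.update (fun j => a (Equiv.swap 0 i j)) 0 x) b y
          simp only [Function.update_self, Function.update_idem] at this
          rw [this]; ring)
      (by
        intro a i r x
        rcases eq_or_ne i 0 with rfl | hi
        · have := N.smul_first r (Function.update a 0 x) b
          simpa using this
        · have h (z : V) := N.apply_eq_neg_swap (Function.update a i z) b hi.symm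
          rw [h, h x]
          simp only [update_swap_comp]
          have := N.smul_first r (Function.update (fun j => a (Equiv.swap 0 i j)) 0 x) b
          simp only [Function.update_self, Function.update_idem] at this
          rw [this]; simp) with
    map_eq_zero_of_eq' := by
      intro a i j h hij
      have h1 := N.apply_eq_neg_swap a b hij
      have h2 : (fun k => a (Equiv.swap i j k)) = a := by
        funext k
        rw [Equiv.swap_apply_def]
        split_ifs with h3 h4
        · rw [h3, h]
        · rw [h4, h]
        · rfl
      rw [h2] at h1
      change N a b = 0
      linarith }

@[simp] theorem form_apply (a b : Fin n → V) : N.form b a = N a b := rfl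

/-- The `n`-inner product as an alternating map with values in alternating forms. -/
def formMap : V [⋀^Fin n]→ₗ[ℝ] (V [⋀^Fin n]→ₗ[ℝ] ℝ) :=
  { MultilinearMap.mk' (fun b => N.form b)
      (by
        intro b i x y
        ext a
        simp only [form_apply, AlternatingMap.add_apply]
        rw [N.symm, N.symm a, N.symm a]
        exact (N.form a).map_update_add b i x y)
      (by
        intro b i r x
        ext a
        simp only [form_apply, AlternatingMap.smul_apply]
        rw [N.symm, N.symm a]
        exact (N.form a).map_update_smul b i r x) with
    map_eq_zero_of_eq' := by
      intro b i j h hij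
      ext a
      change N a b = 0
      rw [N.symm]
      exact (N.form a).map_eq_zero_of_eq b h hij }

@[simp] theorem formMap_apply (a b : Fin n → V) : N.formMap b a = N a b := rfl

theorem formMap_eq_form (b : Fin n → V) : N.formMap b = N.form b := rfl

/-- The linear form `y ↦ ⟨a₁, …, y, …, aₙ | b⟩` with `y` in position `i`. -/
def slot (a b : Fin n → V) (i : Fin n) : V →ₗ[ℝ] ℝ :=
  (N.form b).toMultilinearMap.toLinearMap a i

@[simp] theorem slot_apply (a b : Fin n → V) (i : Fin n) (y : V) :
    N.slot a b i y = N (Function.update a i y) b := rfl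

/-- The vectors `y` for which the form `⟨ · | b⟩` vanishes on all tuples that contain `y`. -/
def rad (b : Fin n → V) : Submodule ℝ V := ⨅ (a : Fin n → V) (i : Fin n), (N.slot a b i).ker

theorem mem_rad_iff {b : Fin n → V} {y : V} :
    y ∈ N.rad b ↔ ∀ a i, N (Function.update a i y) b = 0 := by
  simp [rad]

theorem rad_congr {b b' : Fin n → V} (h : N.form b = N.form b') : N.rad b = N.rad b' := by
  have h' : ∀ a, N a b = N a b' := fun a => by rw [← form_apply, h, form_apply]
  ext y
  simp [mem_rad_iff, h']

/-- This is the form in which axiom (vi) is used: testing y in the slots of b itself is enough.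
Antisymmetry carries the conclusion from the first slot to all slots. -/
theorem mem_rad_of_slot {b : Fin n → V} {y : V}
    (h : ∀ l, N (Function.update b l y) b = 0) : y ∈ N.rad b := by
  have h0 : ∀ a, N (Function.update a 0 y) b = 0 := fun a => by
    refine N.orthogonal _ _ fun i => ?_
    rw [Function.update_self, dropPrepend_eq_comp, ← form_apply, AlternatingMap.map_perm,
      form_apply, h, smul_zero]
  rw [mem_rad_iff]
  intro a i
  rcases eq_or_ne i 0 with rfl | hi
  · exact h0 a
  · rw [N.apply_eq_neg_swap _ b hi.symm, update_swap_comp, h0, neg_zero]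

theorem update_same_apply (b c : Fin n → V) {l m : Fin n} (h : m ≠ l) :
    N (Function.update b l (b m)) c = 0 :=
  (N.form c).map_update_self _ h.symm

theorem slot_sum (b : Fin n → V) (σ : Fin n → ℝ) (l : Fin n) :
    N (Function.update b l (∑ m, σ m • b m)) b = σ l * N b b := by
  rw [← slot_apply, map_sum, Finset.sum_eq_single l]
  · simp
  · intro m _ hm
    simp [N.update_same_apply b b hm]
  · simp

/-- The subtracted sum has the same slot values in b as y, by `slot_sum`. Hence the normalised slot
values are the coefficients of y along b modulo `rad b`. -/
theorem sub_sum_mem_rad {b : Fin n → V} (hb : N b b ≠ 0) (y : V) :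
    y - ∑ m, (N (Function.update b m y) b / N b b) • b m ∈ N.rad b := by
  refine N.mem_rad_of_slot fun l => ?_
  rw [← slot_apply, map_sub, slot_apply, slot_apply, slot_sum, div_mul_cancel₀ _ hb, sub_self]

theorem mem_rad_sup_span_iff {b : Fin n → V} (hb : N b b ≠ 0) (T : Set (Fin n)) (y : V) :
    y ∈ N.rad b ⊔ Submodule.span ℝ (b '' T) ↔
      ∀ l ∉ T, N (Function.update b l y) b = 0 := by
  constructor
  · intro hy l hl
    suffices h : N.rad b ⊔ Submodule.span ℝ (b '' T) ≤ (N.slot b b l).ker from h hy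
    refine sup_le (fun z hz => (N.mem_rad_iff.1 hz) b l) ?_
    rw [Submodule.span_le]
    rintro _ ⟨m, hm, rfl⟩
    exact N.update_same_apply b b (fun h => hl (h ▸ hm))
  · intro h
    rw [← sub_add_cancel y (∑ m, (N (Function.update b m y) b / N b b) • b m)]
    refine Submodule.add_mem_sup (N.sub_sum_mem_rad hb y) (Submodule.sum_mem _ fun m _ => ?_)
    by_cases hm : m ∈ T
    · exact Submodule.smul_mem _ _ (Submodule.subset_span ⟨m, hm, rfl⟩)
    · simp [h m hm]

theorem form_update_add (b : Fin n → V) (k : Fin n) (x y : V) (a : Fin n → V) :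
    N a (Function.update b k (x + y)) =
      N a (Function.update b k x) + N a (Function.update b k y) := by
  rw [N.symm, N.symm a, N.symm a]
  exact (N.form a).map_update_add b k x y

/-- Write b' and b'' for b with w, respectively b k + w, in position k. Since ⟨· | b''⟩ = ⟨· | b⟩ +
⟨· | b'⟩, it suffices that y - s contributes nothing against b'. It lies in `rad b'` plus the span
of the common vectors; each of these either repeats an entry of b or restores b, and ⟨b | b'⟩ = 0.
-/
theorem slot_eq_of_sub_mem_rad {b : Fin n → V} {k : Fin n} {w : V}
    (hb' : N (Function.update b k w) (Function.update b k w) ≠ 0)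
    (hbb' : N b (Function.update b k w) = 0) {y : V}
    (hy' : N (Function.update b k y) (Function.update b k w) = 0) {s : V}
    (hs : s ∈ Submodule.span ℝ (b '' {k}ᶜ))
    (hys : y - s ∈ N.rad (Function.update b k (b k + w))) {l : Fin n} (hl : l ≠ k) :
    N (Function.update b l y) b = N (Function.update b l s) b := by
  have himage : Function.update b k w '' {k}ᶜ = b '' {k}ᶜ :=
    Set.image_congr fun m hm => Function.update_of_ne hm _ _
  have h1 : N (Function.update b l (y - s)) (Function.update b k w) = 0 := by
    suffices h : N.rad (Function.update b k w) ⊔ Submodule.span ℝ (b '' {k}ᶜ) ≤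
        (N.slot b (Function.update b k w) l).ker by
      refine h (Submodule.sub_mem _ ?_ (Submodule.mem_sup_right hs))
      rw [← himage, mem_rad_sup_span_iff _ hb']
      intro m hm
      obtain rfl : m = k := by simpa using hm
      simpa using hy'
    refine sup_le (fun z hz => (N.mem_rad_iff.1 hz) b l) ?_
    rw [Submodule.span_le]
    rintro _ ⟨m, hm, rfl⟩
    rcases eq_or_ne m l with rfl | hml
    · simpa using hbb'
    · exact N.update_same_apply b _ hml
  have h2 := N.mem_rad_iff.1 hys b l
  rw [form_update_add, Function.update_eq_self, h1, add_zero, ← slot_apply, map_sub,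
    sub_eq_zero] at h2
  exact h2

/-- Replacing one vector of `b` by a vector `w` with `⟨b | b'⟩ = 0` does not change the
coefficients of `y` along the other vectors. -/
theorem coeff_eq_of_orthogonal {b : Fin n → V} {k : Fin n} {w : V} (hb : 0 < N b b)
    (hb' : 0 < N (Function.update b k w) (Function.update b k w))
    (hbb' : N b (Function.update b k w) = 0) {y : V}
    (hy : N (Function.update b k y) b = 0)
    (hy' : N (Function.update b k y) (Function.update b k w) = 0)
    {l : Fin n} (hl : l ≠ k) :
    N (Function.update b l y) b / N b b =
      N (Function.update (Function.update b k w) l y) (Function.update b k w) /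
        N (Function.update b k w) (Function.update b k w) := by
  set b' := Function.update b k w with hb'def
  -- The coefficients σ of y relative to b'' serve as intermediary. As σ k = 0, their combination
  -- involves only vectors common to b and b', and the previous lemma, applied in both directions,
  -- identifies σ l with both coefficients.
  set b'' := Function.update b k (b k + w) with hb''def
  have hform (a) : N a b'' = N a b + N a b' := by
    rw [hb''def, form_update_add, Function.update_eq_self]
  have hb'' : N b'' b'' ≠ 0 := by
    rw [hform, N.symm, hform, N.symm b'', hform, hbb', N.symm b' b, hbb']
    positivity
  have hk'' : N (Function.update b'' k y) b'' = 0 := by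
    rw [hform, hb''def, Function.update_idem, hy, hy', add_zero]
  set σ : Fin n → ℝ := fun m => N (Function.update b'' m y) b'' / N b'' b''
  have hσk : σ k = 0 := by simp [σ, hk'']
  have hsum (v : V) : ∑ m, σ m • Function.update b k v m = ∑ m, σ m • b m := by
    refine Finset.sum_congr rfl fun m _ => ?_
    rcases eq_or_ne m k with rfl | hm
    · simp [hσk]
    · rw [Function.update_of_ne hm]
  have hrad : y - ∑ m, σ m • b m ∈ N.rad b'' := by
    rw [← hsum (b k + w)]
    exact N.sub_sum_mem_rad hb'' y
  have hspan : ∑ m, σ m • b m ∈ Submodule.span ℝ (b '' {k}ᶜ) := by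
    refine Submodule.sum_mem _ fun m _ => ?_
    by_cases hm : m = k
    · simp [hm, hσk]
    · exact Submodule.smul_mem _ _ (Submodule.subset_span ⟨m, hm, rfl⟩)
  have hback : Function.update b' k (b k) = b := by simp [hb'def]
  have h1 := N.slot_eq_of_sub_mem_rad hb'.ne' hbb' hy' hspan hrad hl
  have h2 := N.slot_eq_of_sub_mem_rad (b := b') (k := k) (w := b k) (y := y)
    (s := ∑ m, σ m • b m) (by rw [hback]; exact hb.ne') (by rw [hback, N.symm, hbb'])
    (by rw [hback, hb'def, Function.update_idem, hy])
    (by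
      have : b' '' {k}ᶜ = b '' {k}ᶜ :=
        Set.image_congr fun m hm => Function.update_of_ne hm _ _
      rw [this]; exact hspan)
    (by
      have : Function.update b' k (b' k + b k) = b'' := by
        simp [hb'def, hb''def, add_comm]
      rw [this]; exact hrad) hl
  rw [h1, slot_sum, mul_div_cancel_right₀ _ hb.ne', h2, ← hsum w, ← hb'def, slot_sum,
    mul_div_cancel_right₀ _ hb'.ne']

theorem coeff_eq_zero_of_orthogonal {b : Fin n → V} {k : Fin n} {w : V} (hb : 0 < N b b)
    (hb' : 0 < N (Function.update b k w) (Function.update b k w))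
    (hbb' : N b (Function.update b k w) = 0) {y : V} {l : Fin n} (hl : l ≠ k)
    (hw : N (Function.update b l w) b = 0)
    (hu : N (Function.update (Function.update b k w) l (b k)) (Function.update b k w) = 0)
    (hy : N (Function.update (Function.update b k w) l y) (Function.update b k w) = 0) :
    N (Function.update b l y) b = 0 := by
  set b' := Function.update b k w with hb'def
  have hbk : N (Function.update b k (b k)) b' = 0 := by simpa using hbb'
  have hwk : N (Function.update b k w) b = 0 := by rw [N.symm]; exact hbb'
  -- Subtracting the components along b k and w makes `coeff_eq_of_orthogonal` applicable; `hw` and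
  -- `hu` ensure that the l-th coefficients are unaffected.
  set α := N (Function.update b k y) b / N b b
  set β := N (Function.update b k y) b' / N b' b'
  have key := N.coeff_eq_of_orthogonal hb hb' hbb' (y := y - α • b k - β • w) (l := l)
    (by
      rw [← slot_apply, map_sub, map_sub, map_smul, map_smul]
      simp only [slot_apply, hwk, Function.update_eq_self, smul_eq_mul, α]
      rw [div_mul_cancel₀ _ hb.ne']; ring)
    (by
      rw [← slot_apply, map_sub, map_sub, map_smul, map_smul]
      simp only [slot_apply, hbk, smul_eq_mul, ← hb'def, β]
      rw [div_mul_cancel₀ _ hb'.ne']; ring) hl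
  have hbl : N (Function.update b l (b k)) b = 0 := N.update_same_apply b b hl.symm
  have hwl : N (Function.update b' l w) b' = 0 := by
    have := N.update_same_apply b' b' hl.symm
    simpa [hb'def] using this
  have e1 : N (Function.update b' l (y - α • b k - β • w)) b' = 0 := by
    rw [← slot_apply, map_sub, map_sub, map_smul, map_smul]
    simp [hwl, hu, hy]
  have e2 : N (Function.update b l (y - α • b k - β • w)) b = N (Function.update b l y) b := by
    rw [← slot_apply, map_sub, map_sub, map_smul, map_smul]
    simp [hbl, hw]
  rw [← hb'def, e1, e2, zero_div, div_eq_zero_iff] at key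
  exact key.resolve_right hb.ne'

end NInnerProduct

/-! ### Shears of alternating maps and exchange of indices. -/

theorem AlternatingMap.map_add_smul_eq {R M P ι : Type*} [CommRing R] [AddCommGroup M] [Module R M]
    [AddCommGroup P] [Module R P] [Fintype ι] (φ : M [⋀^ι]→ₗ[R] P) (v : ι → M)
    (p : ι) (t : ι → R) (ht : t p = 0) : φ (fun i => v i + t i • v p) = φ v := by
  classical
  suffices h : ∀ T : Finset ι, φ (fun i => if i ∈ T then v i + t i • v p else v i) = φ v by
    simpa using h Finset.univ
  intro T
  induction T using Finset.induction_on with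
  | empty => simp
  | insert a T ha ih =>
    set w : ι → M := fun i => if i ∈ T then v i + t i • v p else v i
    have hwp : w p = v p := by simp [w, ht]
    have hw : (fun i => if i ∈ insert a T then v i + t i • v p else v i) =
        Function.update w a (w a + t a • w p) := by
      funext i
      rcases eq_or_ne i a with rfl | hi
      · rw [hwp]; simp [w, ha]
      · simp [w, hi]
    rw [hw, φ.map_update_add, φ.map_update_smul, Function.update_eq_self, ih]
    rcases eq_or_ne a p with rfl | hap
    · simp [ht]
    · rw [φ.map_update_self _ hap, smul_zero, add_zero]

theorem Function.Injective.exists_perm_of_range_subset {α ι : Type*} [Finite α] {f g : α → ι}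
    (hf : Function.Injective f) (h : Set.range f ⊆ Set.range g) :
    ∃ σ : Equiv.Perm α, f = g ∘ σ := by
  choose σ hσ using fun a => h ⟨a, rfl⟩
  have hinj : Function.Injective σ := fun a b hab => hf (by rw [← hσ, ← hσ b, hab])
  exact ⟨Equiv.ofBijective σ (Finite.injective_iff_bijective.1 hinj), funext fun a => (hσ a).symm⟩

theorem Function.Injective.update_of_notMem {α ι : Type*} [DecidableEq α] {f : α → ι}
    (hf : Function.Injective f) (q : α) {k : ι} (hk : k ∉ Set.range f) :
    Function.Injective (Function.update f q k) := by
  intro a b hab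
  by_cases ha : a = q <;> by_cases hb : b = q
  · rw [ha, hb]
  · subst ha
    simp only [Function.update_self, Function.update_of_ne hb] at hab
    exact absurd ⟨b, hab.symm⟩ hk
  · subst hb
    simp only [Function.update_self, Function.update_of_ne ha] at hab
    exact absurd ⟨a, hab⟩ hk
  · rw [Function.update_of_ne ha, Function.update_of_ne hb] at hab
    exact hf hab

theorem Function.Injective.notMem_range_update {α ι : Type*} [DecidableEq α] {f : α → ι}
    (hf : Function.Injective f) (q : α) {k : ι} (hk : k ∉ Set.range f) :
    f q ∉ Set.range (Function.update f q k) := by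
  rintro ⟨a, ha⟩
  rcases eq_or_ne a q with rfl | haq
  · rw [Function.update_self] at ha
    exact hk ⟨a, ha.symm⟩
  · rw [Function.update_of_ne haq] at ha
    exact haq (hf ha)

/-! ### Removal of the exceptional vectors. -/

namespace NInnerProduct

variable {n : ℕ} [NeZero n] {V : Type*} [AddCommGroup V] [Module ℝ V] (N : NInnerProduct n V)
  {ι : Type*}

theorem apply_perm_perm (a b : Fin n → V) (σ : Equiv.Perm (Fin n)) :
    N (a ∘ σ) (b ∘ σ) = N a b := by
  have h (x y : Fin n → V) : N (x ∘ σ) y = Equiv.Perm.sign σ • N x y :=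
    (N.form y).map_perm x σ
  rw [h, N.symm, h, N.symm, smul_smul, Int.units_mul_self, one_smul]

theorem rad_comp_perm (b : Fin n → V) (σ : Equiv.Perm (Fin n)) :
    N.rad (b ∘ σ) = N.rad b := by
  have h (x y : Fin n → V) : N y (x ∘ σ) = Equiv.Perm.sign σ • N y x := by
    rw [N.symm, N.symm y]
    exact (N.form y).map_perm x σ
  ext y
  simp [mem_rad_iff, h, Units.smul_def]

/-- Modulo the vectors `e s`, `s ∈ S`, each vector of the family `e` is orthogonal to all subspaces
spanned by the other vectors of `n`-element subfamilies that contain `S`. -/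
def IsOrthoAbove (e : ι → V) (S : Finset ι) : Prop :=
  ∀ J : Fin n → ι, Function.Injective J → (S : Set ι) ⊆ Set.range J → ∀ j ∉ Set.range J,
    e j ∈ N.rad (e ∘ J) ⊔ Submodule.span ℝ (e '' S)

theorem apply_self_pos {e : ι → V} (he : LinearIndependent ℝ e) {J : Fin n → ι}
    (hJ : Function.Injective J) : 0 < N (e ∘ J) (e ∘ J) :=
  N.pos _ (he.comp J hJ)

theorem mem_rad_comp_sup_iff {e : ι → V} (he : LinearIndependent ℝ e) {J : Fin n → ι}
    (hJ : Function.Injective J) {S : Finset ι} (hS : (S : Set ι) ⊆ Set.range J) (y : V) :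
    y ∈ N.rad (e ∘ J) ⊔ Submodule.span ℝ (e '' S) ↔
      ∀ l, J l ∉ S → N (Function.update (e ∘ J) l y) (e ∘ J) = 0 := by
  have h : e '' S = (e ∘ J) '' (J ⁻¹' S) := by
    rw [Set.image_comp, Set.image_preimage_eq_of_subset hS]
  rw [h, mem_rad_sup_span_iff _ (N.apply_self_pos he hJ).ne']
  simp

/-- J is turned into J' by exchanging one index at a time, always outside S. Orthogonality above S
supplies the hypotheses of `coeff_eq_of_orthogonal` at each exchange, and the number of indices of
J' missing from J drops. -/
theorem coeff_eq_of_isOrthoAbove {e : ι → V} (he : LinearIndependent ℝ e) {S : Finset ι}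
    (h : N.IsOrthoAbove e S) {s j : ι} {J J' : Fin n → ι}
    (hJ : Function.Injective J) (hJ' : Function.Injective J')
    (hSJ : (S : Set ι) ⊆ Set.range J) (hSJ' : (S : Set ι) ⊆ Set.range J')
    (hjJ : j ∉ Set.range J) (hjJ' : j ∉ Set.range J') {p p' : Fin n} (hp : J p = s)
    (hp' : J' p' = s) :
    N (Function.update (e ∘ J) p (e j)) (e ∘ J) / N (e ∘ J) (e ∘ J) =
      N (Function.update (e ∘ J') p' (e j)) (e ∘ J') / N (e ∘ J') (e ∘ J') := by
  classical
  induction hd : (Finset.univ.image J' \ Finset.univ.image J).card using Nat.strong_induction_on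
    generalizing J p with
  | _ d ih =>
    by_cases hsub : Set.range J' ⊆ Set.range J
    · obtain ⟨σ, rfl⟩ := hJ'.exists_perm_of_range_subset hsub
      have hσ : σ p' = p := hJ (by rw [hp]; exact hp')
      have hu : Function.update (e ∘ J ∘ σ) p' (e j) = Function.update (e ∘ J) p (e j) ∘ σ := by
        rw [Function.update_comp_equiv, ← hσ, Equiv.symm_apply_apply]; rfl
      rw [hu, ← Function.comp_assoc, apply_perm_perm, apply_perm_perm]
    · obtain ⟨k, hkJ', hkJ⟩ := Set.not_subset.1 hsub
      -- J and J' have equally many indices, so J also has one outside J'; k will replace it.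
      obtain ⟨q, hq⟩ : ∃ q, J q ∉ Set.range J' := by
        by_contra! hcon
        obtain ⟨σ, hσ⟩ := hJ.exists_perm_of_range_subset (g := J')
          (by rintro _ ⟨a, rfl⟩; exact hcon a)
        apply hkJ
        obtain ⟨a, rfl⟩ := hkJ'
        exact ⟨σ.symm a, by simp [hσ]⟩
      have hqp : p ≠ q := by
        rintro rfl
        exact hq ⟨p', by rw [hp, hp']⟩
      have hqS : J q ∉ S := fun hmem => hq (hSJ' hmem)
      have hkS : k ∉ S := fun hmem => hkJ (hSJ hmem)
      have hjk : j ≠ k := by rintro rfl; exact hjJ' hkJ'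
      have hinj := hJ.update_of_notMem q hkJ
      have hcomp : e ∘ Function.update J q k = Function.update (e ∘ J) q (e k) :=
        Function.comp_update e J q k
      have hSJ'' : (S : Set ι) ⊆ Set.range (Function.update J q k) := by
        intro i hi
        obtain ⟨a, rfl⟩ := hSJ hi
        refine ⟨a, Function.update_of_ne ?_ _ _⟩
        rintro rfl
        exact hqS hi
      have hjJ'' : j ∉ Set.range (Function.update J q k) := by
        rintro ⟨a, rfl⟩
        rcases eq_or_ne a q with rfl | ha
        · simp at hjk
        · rw [Function.update_of_ne ha] at hjJ
          exact hjJ ⟨a, rfl⟩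
      have horth : N (e ∘ J) (Function.update (e ∘ J) q (e k)) = 0 := by
        rw [N.symm]
        exact (N.mem_rad_comp_sup_iff he hJ hSJ _).1 (h J hJ hSJ k hkJ) q hqS
      have hy' := (N.mem_rad_comp_sup_iff he hinj hSJ'' _).1 (h _ hinj hSJ'' j hjJ'') q (by simpa)
      rw [hcomp, Function.update_idem] at hy'
      have hpos'' := N.apply_self_pos he hinj
      rw [hcomp] at hpos''
      rw [N.coeff_eq_of_orthogonal (N.apply_self_pos he hJ) hpos'' horth
        ((N.mem_rad_comp_sup_iff he hJ hSJ _).1 (h J hJ hSJ j hjJ) q hqS) hy' hqp, ← hcomp]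
      refine ih _ ?_ hinj hSJ'' hjJ'' (by rw [Function.update_of_ne hqp, hp]) rfl
      rw [← hd]
      refine Finset.card_lt_card ⟨?_, ?_⟩
      · intro i hi
        simp only [Finset.mem_sdiff, Finset.mem_image, Finset.mem_univ, true_and] at hi ⊢
        refine ⟨hi.1, ?_⟩
        rintro ⟨a, rfl⟩
        refine hi.2 ⟨a, Function.update_of_ne ?_ _ _⟩
        rintro rfl
        exact hq hi.1
      · intro hsub'
        have hk : k ∈ Finset.univ.image J' \ Finset.univ.image J := by
          simpa using ⟨hkJ', fun a ha => hkJ ⟨a, ha⟩⟩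
        have := hsub' hk
        simp only [Finset.mem_sdiff, Finset.mem_image, Finset.mem_univ, true_and] at this
        exact this.2 ⟨q, Function.update_self _ _ _⟩

/-- t j is minus the common coefficient of e j along e s, or 0 if no admissible J omits j. -/
theorem exists_shear {e : ι → V} (he : LinearIndependent ℝ e) [DecidableEq ι] {S : Finset ι} {s : ι}
    (h : N.IsOrthoAbove e (insert s S)) :
    ∃ t : ι → ℝ, (∀ j ∈ insert s S, t j = 0) ∧
      ∀ J : Fin n → ι, Function.Injective J → ((insert s S : Finset ι) : Set ι) ⊆ Set.range J →
        ∀ j ∉ Set.range J, e j + t j • e s ∈ N.rad (e ∘ J) ⊔ Submodule.span ℝ (e '' S) := by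
  have key : ∀ j, ∃ t : ℝ, (j ∈ insert s S → t = 0) ∧
      ∀ J : Fin n → ι, Function.Injective J → ((insert s S : Finset ι) : Set ι) ⊆ Set.range J →
        ∀ p, J p = s → j ∉ Set.range J →
          N (Function.update (e ∘ J) p (e j)) (e ∘ J) / N (e ∘ J) (e ∘ J) = -t := by
    intro j
    by_cases hex : ∃ J : Fin n → ι, Function.Injective J ∧
        ((insert s S : Finset ι) : Set ι) ⊆ Set.range J ∧ j ∉ Set.range J
    · obtain ⟨J, hJ, hSJ, hj⟩ := hex
      obtain ⟨p, hp⟩ := hSJ (Finset.mem_coe.2 (Finset.mem_insert_self s S))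
      refine ⟨-(N (Function.update (e ∘ J) p (e j)) (e ∘ J) / N (e ∘ J) (e ∘ J)),
        fun hmem => absurd (hSJ hmem) hj, fun J' hJ' hSJ' p' hp' hj' => ?_⟩
      rw [neg_neg]
      exact N.coeff_eq_of_isOrthoAbove he h hJ' hJ hSJ' hSJ hj' hj
        hp' hp
    · exact ⟨0, fun _ => rfl, fun J hJ hSJ p _ hj => absurd ⟨J, hJ, hSJ, hj⟩ hex⟩
  choose t ht0 ht using key
  refine ⟨t, ht0, fun J hJ hSJ j hj => ?_⟩
  have hSJ' : (S : Set ι) ⊆ Set.range J :=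
    (Finset.coe_subset.2 (Finset.subset_insert s S)).trans hSJ
  rw [N.mem_rad_comp_sup_iff he hJ hSJ']
  intro l hl
  rw [← slot_apply, map_add, map_smul, slot_apply, slot_apply, smul_eq_mul]
  by_cases hls : J l = s
  · have h1 := ht j J hJ hSJ l hls hj
    have h2 : Function.update (e ∘ J) l (e s) = e ∘ J := by
      rw [← hls]; exact Function.update_eq_self l (e ∘ J)
    rw [div_eq_iff (N.apply_self_pos he hJ).ne'] at h1
    rw [h1, h2]; ring
  · obtain ⟨p, hp⟩ := hSJ (Finset.mem_coe.2 (Finset.mem_insert_self s S))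
    have h1 := (N.mem_rad_comp_sup_iff he hJ hSJ _).1 (h J hJ hSJ j hj) l (by simp [hls, hl])
    have h2 : N (Function.update (e ∘ J) l (e s)) (e ∘ J) = 0 := by
      rw [← hp]
      exact N.update_same_apply (e ∘ J) (e ∘ J) (by rintro rfl; exact hls hp)
    rw [h1, h2]; ring

/-- Only tuples J omitting s need an argument. To kill the coefficient at l, another index of J
outside S is exchanged for s: the new tuple is covered by the hypothesis, and
`coeff_eq_zero_of_orthogonal` carries the vanishing back to J. -/
theorem isOrthoAbove_of_insert {e : ι → V} (he : LinearIndependent ℝ e) [DecidableEq ι]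
    {S : Finset ι} {s : ι} (hs : s ∉ S) (hcard : S.card + 2 ≤ n)
    (h : ∀ J : Fin n → ι, Function.Injective J → ((insert s S : Finset ι) : Set ι) ⊆ Set.range J →
      ∀ j ∉ Set.range J, e j ∈ N.rad (e ∘ J) ⊔ Submodule.span ℝ (e '' S)) :
    N.IsOrthoAbove e S := by
  intro J hJ hSJ j hj
  by_cases hsJ : s ∈ Set.range J
  · exact h J hJ (by rw [Finset.coe_insert]; exact Set.insert_subset hsJ hSJ) j hj
  have hcov : ∀ l, J l ∉ S → ((insert s S : Finset ι) : Set ι) ⊆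
      Set.range (Function.update J l s) := by
    intro l hl
    rw [Finset.coe_insert]
    refine Set.insert_subset ⟨l, Function.update_self _ _ _⟩ fun i hi => ?_
    obtain ⟨a, rfl⟩ := hSJ hi
    exact ⟨a, Function.update_of_ne (by rintro rfl; exact hl hi) _ _⟩
  have hcov' : ∀ l, J l ∉ S → (S : Set ι) ⊆ Set.range (Function.update J l s) := fun l hl =>
    (Finset.coe_subset.2 (Finset.subset_insert s S)).trans (hcov l hl)
  have hcomp (l) : e ∘ Function.update J l s = Function.update (e ∘ J) l (e s) :=
    Function.comp_update e J l s
  have hreplace : ∀ k, J k ∉ S → ∀ i ∉ Set.range (Function.update J k s), ∀ l, J l ∉ S →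
      N (Function.update (Function.update (e ∘ J) k (e s)) l (e i))
        (Function.update (e ∘ J) k (e s)) = 0 := by
    intro k hk i hi l hl
    have hinj := hJ.update_of_notMem k hsJ
    have := (N.mem_rad_comp_sup_iff he hinj (hcov' k hk) _).1 (h _ hinj (hcov k hk) i hi) l
      (by
        rcases eq_or_ne l k with rfl | hlk
        · simpa using hs
        · rwa [Function.update_of_ne hlk])
    rwa [hcomp] at this
  have hs0 : ∀ l, J l ∉ S → N (Function.update (e ∘ J) l (e s)) (e ∘ J) = 0 := by
    intro l hl
    have := hreplace l hl (J l) (hJ.notMem_range_update l hsJ) l hl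
    rw [Function.update_idem] at this
    rw [N.symm]
    rwa [show Function.update (e ∘ J) l (e (J l)) = e ∘ J from
      Function.update_eq_self l (e ∘ J)] at this
  rw [N.mem_rad_comp_sup_iff he hJ hSJ]
  intro l hl
  by_cases hjs : j = s
  · rw [hjs]; exact hs0 l hl
  -- The bound `hcard` leaves at least two positions of J outside S.
  obtain ⟨k, hkl, hk⟩ : ∃ k, k ≠ l ∧ J k ∉ S := by
    by_contra! hcon
    have hsub : (Finset.univ.erase l).image J ⊆ S := by
      intro i hi
      simp only [Finset.mem_image, Finset.mem_erase, Finset.mem_univ, and_true] at hi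
      obtain ⟨a, ha, rfl⟩ := hi
      exact hcon a ha
    have := Finset.card_le_card hsub
    rw [Finset.card_image_of_injective _ hJ, Finset.card_erase_of_mem (Finset.mem_univ _),
      Finset.card_univ, Fintype.card_fin] at this
    omega
  have hjk : j ∉ Set.range (Function.update J k s) := by
    rintro ⟨a, rfl⟩
    rcases eq_or_ne a k with rfl | ha
    · simp at hjs
    · rw [Function.update_of_ne ha] at hj
      exact hj ⟨a, rfl⟩
  have hpos := N.apply_self_pos he (hJ.update_of_notMem k hsJ)
  rw [hcomp] at hpos
  exact N.coeff_eq_zero_of_orthogonal (N.apply_self_pos he hJ) hpos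
    (by rw [N.symm]; exact hs0 k hk) hkl.symm (hs0 l hl)
    (hreplace k hk (J k) (hJ.notMem_range_update k hsJ) l hl) (hreplace k hk j hjk l hl)

theorem exists_isOrthoAbove_empty (S : Finset ι) (hS : S.card + 1 ≤ n)
    (e : ι → V) (he : LinearIndependent ℝ e) (h : N.IsOrthoAbove e S) :
    ∃ e' : ι → V, LinearIndependent ℝ e' ∧
      Submodule.span ℝ (Set.range e) ≤ Submodule.span ℝ (Set.range e') ∧
      N.IsOrthoAbove e' ∅ := by
  classical
  induction S using Finset.induction_on generalizing e with
  | empty => exact ⟨e, he, le_rfl, h⟩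
  | insert s S hs ih =>
    rw [Finset.card_insert_of_notMem hs] at hS
    obtain ⟨t, ht0, ht⟩ := N.exists_shear he h
    have hts : t s = 0 := ht0 s (Finset.mem_insert_self s S)
    set e' : ι → V := fun j => e j + t j • e s with he'def
    have he's : e' s = e s := by simp [he'def, hts]
    have he' : LinearIndependent ℝ e' :=
      (linearIndependent_add_smul_iff hts).2 he
    have himage : e' '' S = e '' S := Set.image_congr fun j hj => by
      simp [he'def, ht0 j (Finset.mem_insert_of_mem hj)]
    have hstep : N.IsOrthoAbove e' S := by
      refine N.isOrthoAbove_of_insert he' hs (by omega) fun J hJ hSJ j hj => ?_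
      obtain ⟨p, hp⟩ := hSJ (Finset.mem_coe.2 (Finset.mem_insert_self s S))
      -- As s occurs in J, the shear adds multiples of one entry of the tuple to the others, so the
      -- form and its radical are unchanged.
      have hform : N.form (e' ∘ J) = N.form (e ∘ J) := by
        have := N.formMap.map_add_smul_eq (e ∘ J) p (t ∘ J) (by simp [hp, hts])
        simp only [formMap_eq_form, Function.comp_apply, hp] at this
        exact this
      rw [N.rad_congr hform, himage]
      exact ht J hJ hSJ j hj
    obtain ⟨f, hf, hspan, hfo⟩ := ih (by omega) e' he' hstep
    refine ⟨f, hf, le_trans ?_ hspan, hfo⟩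
    rw [Submodule.span_le]
    rintro _ ⟨j, rfl⟩
    have : e j = e' j - t j • e' s := by rw [he's]; simp [he'def]
    rw [this]
    exact Submodule.sub_mem _ (Submodule.subset_span ⟨j, rfl⟩)
      (Submodule.smul_mem _ _ (Submodule.subset_span ⟨s, rfl⟩))

end NInnerProduct

/-! ### The starting family and the orthogonal family. -/

namespace NInnerProduct

variable {n : ℕ} [NeZero n] {V : Type*} [AddCommGroup V] [Module ℝ V] (N : NInnerProduct n V)

/-- The bilinear form `(y, z) ↦ ⟨y, a₂, …, aₙ | z, a₂, …, aₙ⟩`. -/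
def firstSlotBilin (a : Fin n → V) : LinearMap.BilinForm ℝ V :=
  LinearMap.mk₂ ℝ (fun y z => N (Function.update a 0 y) (Function.update a 0 z))
    (fun y y' z => (N.form (Function.update a 0 z)).map_update_add a 0 y y')
    (fun r y z => (N.form (Function.update a 0 z)).map_update_smul a 0 r y)
    (fun y z z' => N.form_update_add a 0 z z' _)
    (fun r y z => by
      rw [N.symm, N.symm _ (Function.update a 0 z)]
      exact (N.form (Function.update a 0 y)).map_update_smul a 0 r z)

theorem exists_isOrthoAbove (a : Fin n → V) (ha : LinearIndependent ℝ a) (W : Submodule ℝ V)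
    [FiniteDimensional ℝ W] (haW : ∀ i, a i ∈ W) :
    ∃ (p : ℕ) (e : {i : Fin n // i ≠ 0} ⊕ Fin p → V), LinearIndependent ℝ e ∧
      W ≤ Submodule.span ℝ (Set.range e) ∧
      N.IsOrthoAbove e (Finset.univ.image Sum.inl) := by
  set x : {i : Fin n // i ≠ 0} → V := fun i => a i
  have hx : LinearIndependent ℝ x := ha.comp _ Subtype.val_injective
  set X := Submodule.span ℝ (Set.range x) with hX
  have hXW : X ≤ W := by
    rw [hX, Submodule.span_le]
    rintro _ ⟨i, rfl⟩
    exact haW i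
  obtain ⟨Q, hQ⟩ := X.exists_isCompl
  -- By the modular law, a complement of X in V meets W in a complement of X in W.
  obtain ⟨U, hUW, hdisj, hsup⟩ : ∃ U ≤ W, Disjoint X U ∧ X ⊔ U = W :=
    ⟨Q ⊓ W, inf_le_right, hQ.disjoint.mono_right inf_le_left, by
      rw [← sup_inf_assoc_of_le Q hXW, hQ.sup_eq_top, top_inf_eq]⟩
  have : FiniteDimensional ℝ U := Submodule.finiteDimensional_of_le hUW
  have hβ : LinearMap.IsSymm ((N.firstSlotBilin a).restrict U) := ⟨fun y z => N.symm _ _⟩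
  obtain ⟨v, hv⟩ := LinearMap.BilinForm.exists_orthogonal_basis hβ
  have hvspan : Submodule.span ℝ (Set.range fun i => (v i : V)) = U := by
    have := congrArg (Submodule.map U.subtype) v.span_eq
    rw [Submodule.map_span, ← Set.range_comp, Submodule.map_top, Submodule.range_subtype] at this
    exact this
  have hLI : LinearIndependent ℝ (Sum.elim x fun i => (v i : V)) := by
    refine hx.sum_type (v.linearIndependent.map' U.subtype U.ker_subtype) ?_
    change Disjoint X (Submodule.span ℝ (Set.range fun i => (v i : V)))
    rwa [hvspan]
  refine ⟨_, Sum.elim x fun i => (v i : V), hLI, ?_, ?_⟩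
  · rw [Set.Sum.elim_range, Submodule.span_union, hvspan, ← hX, hsup]
  intro J hJ hSJ j hj
  obtain ⟨c, rfl⟩ : ∃ c, j = Sum.inr c := by
    rcases j with i | c
    · exact absurd (hSJ (by simp)) hj
    · exact ⟨c, rfl⟩
  obtain ⟨q, d, hq⟩ : ∃ q d, J q = Sum.inr d := by
    by_contra! hcon
    have hleft : ∀ q, ∃ i, J q = Sum.inl i := fun q => by
      rcases h : J q with i | d
      · exact ⟨i, rfl⟩
      · exact absurd h (hcon q d)
    choose f hf using hleft
    have hfinj : Function.Injective f := fun q q' h => hJ (by rw [hf, hf, h])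
    have := Fintype.card_le_of_injective f hfinj
    have h2 : Fintype.card {i : Fin n // i ≠ 0} < Fintype.card (Fin n) :=
      Fintype.card_subtype_lt (x := 0) (by simp)
    omega
  -- J consists of all n-1 left indices and the single right index d. `J₀` orders it so that the
  -- tuple is a with v d in place of the first vector; only that position lies outside S, and there
  -- the claim is orthogonality of v.
  set J₀ : Fin n → {i : Fin n // i ≠ 0} ⊕ Fin (Module.finrank ℝ U) :=
    fun i => if h : i ≠ 0 then Sum.inl ⟨i, h⟩ else Sum.inr d with hJ₀
  have hJ₀inj : Function.Injective J₀ := by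
    intro i i' h
    by_cases hi : i = 0 <;> by_cases hi' : i' = 0 <;> simp_all
  obtain ⟨σ, hσ⟩ := hJ₀inj.exists_perm_of_range_subset (g := J) (by
    rintro _ ⟨i, rfl⟩
    by_cases hi : i = 0
    · exact ⟨q, by simp [hJ₀, hi, hq]⟩
    · simp only [hJ₀, hi, ne_eq, not_false_eq_true, dif_pos]
      exact hSJ (by simp))
  rw [← N.rad_comp_perm _ σ, Function.comp_assoc, ← hσ]
  rw [N.mem_rad_comp_sup_iff hLI hJ₀inj]
  · intro l hl
    obtain rfl : l = 0 := by
      by_contra hl0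
      simp [hJ₀, hl0] at hl
    have he : Sum.elim x (fun i => (v i : V)) ∘ J₀ = Function.update a 0 (v d : V) := by
      funext i
      by_cases hi : i = 0
      · subst hi; simp [hJ₀]
      · simp [hJ₀, hi, x]
    rw [he, Function.update_idem]
    refine hv (i := c) (j := d) (fun hcd => hj ?_)
    exact ⟨q, by rw [hq, ← hcd]⟩
  · intro i hi
    obtain ⟨i, -, rfl⟩ := Finset.mem_image.1 (Finset.mem_coe.1 hi)
    exact ⟨i, by simp [hJ₀, i.2]⟩

theorem exists_orthogonal_family (a : Fin n → V) (ha : LinearIndependent ℝ a) (W : Submodule ℝ V)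
    [FiniteDimensional ℝ W] (haW : ∀ i, a i ∈ W) :
    ∃ (m : ℕ) (e : Fin m → V), LinearIndependent ℝ e ∧ W ≤ Submodule.span ℝ (Set.range e) ∧
      ∀ I J : Fin n → Fin m, Function.Injective J → (∃ k, I k ∉ Set.range J) →
        N (e ∘ I) (e ∘ J) = 0 := by
  obtain ⟨p, e, he, hW, ho⟩ := N.exists_isOrthoAbove a ha W haW
  obtain ⟨f, hf, hspan, hfo⟩ := N.exists_isOrthoAbove_empty _ (by
    have h2 : Fintype.card {i : Fin n // i ≠ 0} < Fintype.card (Fin n) :=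
      Fintype.card_subtype_lt (x := 0) (by simp)
    rw [Finset.card_image_of_injective _ Sum.inl_injective, Finset.card_univ]
    simpa using h2) e he ho
  set φ := Fintype.equivFin ({i : Fin n // i ≠ 0} ⊕ Fin p)
  refine ⟨_, f ∘ φ.symm, hf.comp _ φ.symm.injective, ?_, ?_⟩
  · rw [EquivLike.range_comp]
    exact hW.trans hspan
  · rintro I J hJ ⟨k, hk⟩
    have hmem := hfo (φ.symm ∘ J) (φ.symm.injective.comp hJ) (by simp) (φ.symm (I k)) (by
      rintro ⟨i, hi⟩
      exact hk ⟨i, φ.symm.injective hi⟩)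
    simp only [Finset.coe_empty, Set.image_empty, Submodule.span_empty, sup_bot_eq] at hmem
    have := N.mem_rad_iff.1 hmem (f ∘ φ.symm ∘ I) k
    rwa [show Function.update (f ∘ φ.symm ∘ I) k (f (φ.symm (I k))) = f ∘ φ.symm ∘ I from
      Function.update_eq_self k _] at this

/-! ### The inner product on the exterior power. -/

/-- The bilinear form on the exterior power that extends the `n`-inner product. -/
noncomputable def bilin : LinearMap.BilinForm ℝ (⋀[ℝ]^n V) :=
  exteriorPower.alternatingMapLinearEquiv
    (exteriorPower.alternatingMapLinearEquiv.toLinearMap.compAlternatingMap N.formMap)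

@[simp] theorem bilin_ιMulti (a b : Fin n → V) :
    N.bilin (exteriorPower.ιMulti ℝ n a) (exteriorPower.ιMulti ℝ n b) = N a b := by
  simp [bilin, N.symm a b]

theorem bilin_symm (v w : ⋀[ℝ]^n V) : N.bilin v w = N.bilin w v := by
  have h : N.bilin = N.bilin.flip := by
    apply exteriorPower.linearMap_ext
    ext a : 1
    apply exteriorPower.linearMap_ext
    ext b
    simp [N.symm a b]
  exact LinearMap.congr_fun₂ h v w

end NInnerProduct

theorem exteriorPower.exists_finiteDimensional_mem_range_map {K V : Type*} [Field K]
    [AddCommGroup V] [Module K V] (n : ℕ) (w : ⋀[K]^n V) :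
    ∃ W : Submodule K V, FiniteDimensional K W ∧
      w ∈ LinearMap.range (exteriorPower.map n W.subtype) := by
  have hmono : ∀ W W' : Submodule K V, W ≤ W' →
      LinearMap.range (exteriorPower.map n W.subtype) ≤
        LinearMap.range (exteriorPower.map n W'.subtype) := by
    intro W W' h
    rw [← Submodule.subtype_comp_inclusion W W' h, exteriorPower.map_comp]
    exact LinearMap.range_comp_le_range _ _
  have hw : w ∈ Submodule.span K (Set.range (exteriorPower.ιMulti K n (M := V))) := by
    rw [exteriorPower.ιMulti_span]; trivial
  induction hw using Submodule.span_induction with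
  | mem w hw =>
    obtain ⟨a, rfl⟩ := hw
    refine ⟨Submodule.span K (Set.range a), FiniteDimensional.span_of_finite K (Set.finite_range a),
      exteriorPower.ιMulti K n fun i => ⟨a i, Submodule.subset_span ⟨i, rfl⟩⟩, ?_⟩
    rw [exteriorPower.map_apply_ιMulti]
    rfl
  | zero => exact ⟨⊥, inferInstance, Submodule.zero_mem _⟩
  | add x y _ _ hx hy =>
    obtain ⟨W, hW, hxW⟩ := hx
    obtain ⟨W', hW', hyW'⟩ := hy
    exact ⟨W ⊔ W', inferInstance, Submodule.add_mem _ (hmono _ _ le_sup_left hxW)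
      (hmono _ _ le_sup_right hyW')⟩
  | smul r x _ hx =>
    obtain ⟨W, hW, hxW⟩ := hx
    exact ⟨W, hW, Submodule.smul_mem _ _ hxW⟩

namespace NInnerProduct

variable {n : ℕ} [NeZero n] {V : Type*} [AddCommGroup V] [Module ℝ V] (N : NInnerProduct n V)

theorem bilin_self_pos (hV : (n : Cardinal) ≤ Module.rank ℝ V) {w : ⋀[ℝ]^n V} (hw : w ≠ 0) :
    0 < N.bilin w w := by
  -- The dimension hypothesis provides the frame that starts the construction; W is enlarged below
  -- to contain it.
  obtain ⟨a, ha⟩ : ∃ a : Fin n → V, LinearIndependent ℝ a := Module.le_rank_iff.1 hV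
  obtain ⟨W, hW, hwW⟩ := exteriorPower.exists_finiteDimensional_mem_range_map n w
  have : FiniteDimensional ℝ (Submodule.span ℝ (Set.range a)) :=
    FiniteDimensional.span_of_finite ℝ (Set.finite_range a)
  obtain ⟨m, e, he, hWe, horth⟩ := N.exists_orthogonal_family a ha
    (W ⊔ Submodule.span ℝ (Set.range a))
    (fun i => Submodule.mem_sup_right (Submodule.subset_span ⟨i, rfl⟩))
  obtain ⟨z, rfl⟩ : w ∈ LinearMap.range
      (exteriorPower.map n (Submodule.span ℝ (Set.range e)).subtype) := by
    rw [← Submodule.subtype_comp_inclusion _ _ (le_sup_left.trans hWe),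
      exteriorPower.map_comp] at hwW
    exact LinearMap.range_comp_le_range _ _ hwW
  set B := (Module.Basis.span he).exteriorPower n
  set F : Set.powersetCard (Fin m) n → Fin n → Fin m :=
    fun s => Set.powersetCard.ofFinEmbEquiv.symm s with hF
  have hFinj (s) : Function.Injective (F s) := (Set.powersetCard.ofFinEmbEquiv.symm s).injective
  have hB (s) : exteriorPower.map n (Submodule.span ℝ (Set.range e)).subtype (B s) =
      exteriorPower.ιMulti ℝ n (e ∘ F s) := by
    rw [exteriorPower.basis_apply, exteriorPower.map_apply_ιMulti_family]
    simp only [exteriorPower.ιMulti_family, hF]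
    congr 1
    funext i
    simp [Module.Basis.span_apply]
  have hdiag (s t) (hst : s ≠ t) : N (e ∘ F s) (e ∘ F t) = 0 := by
    obtain ⟨i, his, hit⟩ := (Set.powersetCard.exists_mem_notMem_iff_ne s t).mp hst
    obtain ⟨k, rfl⟩ := (Set.powersetCard.mem_range_ofFinEmbEquiv_symm_iff_mem s i).mpr his
    refine horth _ _ (hFinj t) ⟨k, fun hk => hit ?_⟩
    exact (Set.powersetCard.mem_range_ofFinEmbEquiv_symm_iff_mem t _).mp hk
  have hsum : N.bilin (exteriorPower.map n (Submodule.span ℝ (Set.range e)).subtype z)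
      (exteriorPower.map n (Submodule.span ℝ (Set.range e)).subtype z) =
      ∑ s, B.repr z s ^ 2 * N (e ∘ F s) (e ∘ F s) := by
    conv_lhs => rw [← B.sum_repr z]
    simp only [map_sum, map_smul, hB, LinearMap.sum_apply, LinearMap.smul_apply, bilin_ιMulti,
      smul_eq_mul]
    refine Finset.sum_congr rfl fun s _ => ?_
    rw [Finset.sum_eq_single s]
    · ring
    · intro t _ hts
      simp [hdiag t s hts]
    · simp
  have hpos (s) : 0 < N (e ∘ F s) (e ∘ F s) := N.apply_self_pos he (hFinj s)
  rw [hsum]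
  obtain ⟨s, hs⟩ : ∃ s, B.repr z s ≠ 0 := by
    by_contra! hcon
    apply hw
    rw [← B.sum_repr z]
    simp [hcon]
  exact Finset.sum_pos' (fun t _ => mul_nonneg (sq_nonneg _) (hpos t).le)
    ⟨s, Finset.mem_univ s, mul_pos (by positivity) (hpos s)⟩

/-- The inner product on the exterior power that extends the `n`-inner product. -/
noncomputable abbrev innerCore (hV : (n : Cardinal) ≤ Module.rank ℝ V) :
    InnerProductSpace.Core ℝ (⋀[ℝ]^n V) where
  inner v w := N.bilin v w
  conj_inner_symm v w := N.bilin_symm w v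
  re_inner_nonneg v := by
    rcases eq_or_ne v 0 with rfl | hv
    · simp
    · exact (N.bilin_self_pos hV hv).le
  add_left u v w := by simp
  smul_left u v r := by simp
  definite v hv := by
    by_contra hne
    exact (N.bilin_self_pos hV hne).ne' hv

/-- This yields uniqueness of the extension. The coefficients p are not unique, as tuples may repeat
or permute indices. -/
theorem exists_wedgeSum_eq {n : ℕ} {V : Type*} [AddCommGroup V] [Module ℝ V] {ι : Type*}
    (e : Module.Basis ι ℝ V) (w : ⋀[ℝ]^n V) :
    ∃ p : (Fin n → ι) →₀ ℝ, wedgeSum e p = w := by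
  have h := exteriorPower.ιMulti_span_of_span ℝ n V e.span_eq
  have hw : w ∈ Submodule.span ℝ (Set.range fun I : Fin n → ι =>
      exteriorPower.ιMulti ℝ n fun k => e (I k)) := by
    have htop : w ∈ (⊤ : Submodule ℝ (⋀[ℝ]^n V)) := trivial
    rw [← h] at htop
    refine Submodule.span_mono ?_ htop
    rintro _ ⟨a, ha, rfl⟩
    choose I hI using fun k => ha ⟨k, rfl⟩
    exact ⟨I, by simp only [hI]⟩
  obtain ⟨p, hp⟩ := (Finsupp.mem_span_range_iff_exists_finsupp).1 hw
  exact ⟨p, hp⟩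

theorem isExtensionFromBasis_bilin {ι : Type*} (e : Module.Basis ι ℝ V) :
    N.IsExtensionFromBasis e fun v w => N.bilin v w := by
  intro p q
  simp only [wedgeSum, Finsupp.sum, map_sum, LinearMap.sum_apply, map_smul, LinearMap.smul_apply,
    bilin_ιMulti, smul_eq_mul, Finset.mul_sum]
  rw [Finset.sum_comm]
  refine Finset.sum_congr rfl fun I _ => Finset.sum_congr rfl fun J _ => ?_
  ring

theorem IsExtensionFromBasis.eq {ι : Type*} {e : Module.Basis ι ℝ V}
    {f g : ⋀[ℝ]^n V → ⋀[ℝ]^n V → ℝ} (hf : N.IsExtensionFromBasis e f)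
    (hg : N.IsExtensionFromBasis e g) : f = g := by
  funext v w
  obtain ⟨p, rfl⟩ := exists_wedgeSum_eq e v
  obtain ⟨q, rfl⟩ := exists_wedgeSum_eq e w
  rw [hf, hg]

end NInnerProduct

/-! ### The angle metric on the Grassmannian. -/

section LineAngle

variable {E : Type*} [NormedAddCommGroup E] [InnerProductSpace ℝ E]

/-- The angle between the lines spanned by two vectors. -/
noncomputable def lineAngle (x y : E) : ℝ := Real.arccos (|inner ℝ x y| / (‖x‖ * ‖y‖))

theorem lineAngle_le_angle (x y : E) : lineAngle x y ≤ InnerProductGeometry.angle x y :=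
  Real.arccos_le_arccos (by gcongr; exact le_abs_self _)

theorem lineAngle_neg_right (x y : E) : lineAngle x (-y) = lineAngle x y := by
  simp [lineAngle]

theorem lineAngle_comm (x y : E) : lineAngle x y = lineAngle y x := by
  rw [lineAngle, lineAngle, real_inner_comm, mul_comm]

theorem exists_angle_eq_lineAngle (x y : E) :
    ∃ y', (y' = y ∨ y' = -y) ∧ InnerProductGeometry.angle x y' = lineAngle x y := by
  rcases le_total 0 (inner ℝ x y) with h | h
  · exact ⟨y, Or.inl rfl, by rw [InnerProductGeometry.angle, lineAngle, abs_of_nonneg h]⟩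
  · exact ⟨-y, Or.inr rfl, by
      rw [InnerProductGeometry.angle, lineAngle, abs_of_nonpos h, inner_neg_right, norm_neg]⟩

/-- Signs of y and then of z are chosen so that the two angles on the right become vector angles;
the triangle inequality for these applies, and a line angle never exceeds the vector angle. -/
theorem lineAngle_triangle (x y z : E) : lineAngle x z ≤ lineAngle x y + lineAngle y z := by
  obtain ⟨y', hy', hxy⟩ := exists_angle_eq_lineAngle x y
  obtain ⟨z', hz', hyz⟩ := exists_angle_eq_lineAngle y' z
  have h1 : lineAngle x z = lineAngle x z' := by
    rcases hz' with rfl | rfl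
    · rfl
    · rw [lineAngle_neg_right]
  have h2 : lineAngle y' z = lineAngle y z := by
    rcases hy' with rfl | rfl
    · rfl
    · rw [lineAngle_comm, lineAngle_neg_right, lineAngle_comm]
  rw [h1, ← hxy, ← h2, ← hyz]
  exact (lineAngle_le_angle x z').trans (InnerProductGeometry.angle_le_angle_add_angle x y' z')

theorem lineAngle_self {x : E} (hx : x ≠ 0) : lineAngle x x = 0 := by
  rw [lineAngle, real_inner_self_eq_norm_mul_norm, abs_of_nonneg (by positivity),
    div_self (by positivity), Real.arccos_one]

theorem exists_smul_eq_of_lineAngle_eq_zero {x y : E} (h : lineAngle x y = 0) :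
    ∃ r : ℝ, y = r • x := by
  have h1 : |inner ℝ x y / (‖x‖ * ‖y‖)| = 1 := by
    refine le_antisymm (abs_real_inner_div_norm_mul_norm_le_one x y) ?_
    rw [abs_div, abs_of_nonneg (by positivity : 0 ≤ ‖x‖ * ‖y‖)]
    exact Real.arccos_eq_zero.1 h
  obtain ⟨-, r, -, hr⟩ := (abs_real_inner_div_norm_mul_norm_eq_one_iff x y).1 h1
  exact ⟨r, hr⟩

end LineAngle

/-- If v lay in span b but not in span a, a projection P could kill v and fix every a i. Then P ∘ b
is dependent, and applying the exterior power of P gives a₁ ∧ … ∧ aₙ = 0. -/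
theorem span_le_span_of_ιMulti_eq_smul {K V : Type*} [Field K] [AddCommGroup V] [Module K V]
    {n : ℕ} {a b : Fin n → V} (ha0 : exteriorPower.ιMulti K n a ≠ 0) {r : K}
    (h : exteriorPower.ιMulti K n a = r • exteriorPower.ιMulti K n b) :
    Submodule.span K (Set.range b) ≤ Submodule.span K (Set.range a) := by
  intro v hv
  by_contra hva
  obtain ⟨g, hgv, hg⟩ := Submodule.exists_le_ker_of_notMem hva
  set P : V →ₗ[K] V := LinearMap.id - ((g v)⁻¹ • g).smulRight v with hP
  have hPv : P v = 0 := by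
    simp [hP, inv_mul_cancel₀ hgv]
  have hPa : P ∘ a = a := by
    funext i
    have : g (a i) = 0 := hg (Submodule.subset_span ⟨i, rfl⟩)
    simp [hP, this]
  have hPb : ¬LinearIndependent K (P ∘ b) := by
    intro hli
    obtain ⟨c, rfl⟩ := (Submodule.mem_span_range_iff_exists_fun K).1 hv
    have hsum : ∑ i, c i • (P ∘ b) i = 0 := by
      rw [← hPv, map_sum]
      simp
    have hc := Fintype.linearIndependent_iff.1 hli c hsum
    exact hva (by simp [hc])
  have h2 := congrArg (exteriorPower.map n P) h
  rw [map_smul, exteriorPower.map_apply_ιMulti, exteriorPower.map_apply_ιMulti, hPa,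
    AlternatingMap.map_linearDependent _ _ hPb, smul_zero] at h2
  exact ha0 h2

namespace Grassmann

variable {n : ℕ} [NeZero n] {V : Type*} [AddCommGroup V] [Module ℝ V]

theorem ofFrame_eq (S : Grassmann n V) (a : {a : Fin n → V // LinearIndependent ℝ a})
    (haS : ∀ i, a.1 i ∈ S.toSubmodule) : ofFrame a = S := by
  have : FiniteDimensional ℝ S.toSubmodule :=
    FiniteDimensional.of_finrank_pos (by rw [S.finrank_eq]; exact Nat.pos_of_neZero n)
  ext1
  refine Submodule.eq_of_le_of_finrank_eq ?_ ((ofFrame a).finrank_eq.trans S.finrank_eq.symm)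
  rw [ofFrame, Submodule.span_le]
  rintro _ ⟨i, rfl⟩
  exact haS i

theorem ofFrame_eq_of_span_le {a b : {a : Fin n → V // LinearIndependent ℝ a}}
    (h : Submodule.span ℝ (Set.range a.1) ≤ Submodule.span ℝ (Set.range b.1)) :
    ofFrame a = ofFrame b :=
  ofFrame_eq _ a fun i =>
    h (Submodule.subset_span (Set.mem_range_self i))

theorem exists_ofFrame_eq (S : Grassmann n V) :
    ∃ a : {a : Fin n → V // LinearIndependent ℝ a}, ofFrame a = S := by
  have : FiniteDimensional ℝ S.toSubmodule :=
    FiniteDimensional.of_finrank_pos (by rw [S.finrank_eq]; exact Nat.pos_of_neZero n)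
  set e := Module.finBasisOfFinrankEq ℝ S.toSubmodule S.finrank_eq
  have hli : LinearIndependent ℝ fun i => (e i : V) :=
    e.linearIndependent.map' S.toSubmodule.subtype S.toSubmodule.ker_subtype
  exact ⟨⟨fun i => e i, hli⟩, ofFrame_eq S ⟨fun i => e i, hli⟩ fun i => (e i).2⟩

/-- A basis of the subspace `S`. -/
noncomputable def frame (S : Grassmann n V) :
    {a : Fin n → V // LinearIndependent ℝ a} :=
  S.exists_ofFrame_eq.choose

theorem ofFrame_frame (S : Grassmann n V) : ofFrame S.frame = S :=
  S.exists_ofFrame_eq.choose_spec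

theorem frame_mem (S : Grassmann n V) (i : Fin n) : S.frame.1 i ∈ S.toSubmodule := by
  have h : S.frame.1 i ∈ (ofFrame S.frame).toSubmodule :=
    Submodule.subset_span (Set.mem_range_self i)
  rwa [S.ofFrame_frame] at h

end Grassmann

namespace NInnerProduct

variable {n : ℕ} [NeZero n] {V : Type*} [AddCommGroup V] [Module ℝ V] (N : NInnerProduct n V)

/-- The factor c is the determinant of the change of basis; it is nonzero by positivity on a'. -/
theorem exists_apply_eq_mul (S : Grassmann n V) {a a' : Fin n → V} (ha : LinearIndependent ℝ a)
    (haS : ∀ i, a i ∈ S.toSubmodule) (ha' : LinearIndependent ℝ a')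
    (haS' : ∀ i, a' i ∈ S.toSubmodule) : ∃ c ≠ 0, ∀ b, N a' b = c * N a b := by
  have hLI : LinearIndependent ℝ fun i => (⟨a i, haS i⟩ : S.toSubmodule) :=
    LinearIndependent.of_comp S.toSubmodule.subtype ha
  set e := basisOfLinearIndependentOfCardEqFinrank hLI (by simp [S.finrank_eq])
  have he (i) : (e i : V) = a i := by simp [e]
  have h : ∀ b, N a' b = e.det (fun i => ⟨a' i, haS' i⟩) * N a b := by
    intro b
    have := congrArg (fun φ => φ fun i => (⟨a' i, haS' i⟩ : S.toSubmodule))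
      (((N.form b).compLinearMap S.toSubmodule.subtype).eq_smul_basis_det e)
    simpa [he, Function.comp_def, mul_comm] using this
  refine ⟨_, fun h0 => ?_, h⟩
  have := N.pos a' ha'
  rw [h, h0, zero_mul] at this
  exact this.false

theorem abs_div_nnorm_congr (S T : Grassmann n V) {a a' b b' : Fin n → V}
    (ha : LinearIndependent ℝ a) (haS : ∀ i, a i ∈ S.toSubmodule)
    (ha' : LinearIndependent ℝ a') (haS' : ∀ i, a' i ∈ S.toSubmodule)
    (hb : LinearIndependent ℝ b) (hbT : ∀ i, b i ∈ T.toSubmodule)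
    (hb' : LinearIndependent ℝ b') (hbT' : ∀ i, b' i ∈ T.toSubmodule) :
    |N a' b'| / (N.nnorm a' * N.nnorm b') = |N a b| / (N.nnorm a * N.nnorm b) := by
  obtain ⟨c, hc, hca⟩ := N.exists_apply_eq_mul S ha haS ha' haS'
  obtain ⟨d, hd, hdb⟩ := N.exists_apply_eq_mul T hb hbT hb' hbT'
  have h1 : N.nnorm a' = |c| * N.nnorm a := by
    rw [nnorm, nnorm, hca, N.symm, hca, ← mul_assoc, Real.sqrt_mul (mul_self_nonneg c),
      Real.sqrt_mul_self_eq_abs]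
  have h2 : N.nnorm b' = |d| * N.nnorm b := by
    rw [nnorm, nnorm, hdb, N.symm, hdb, ← mul_assoc, Real.sqrt_mul (mul_self_nonneg d),
      Real.sqrt_mul_self_eq_abs]
  rw [hca, N.symm, hdb, N.symm b, h1, h2, abs_mul, abs_mul, ← mul_assoc, mul_mul_mul_comm,
    mul_div_mul_left _ _ (by positivity)]

theorem ιMulti_ne_zero (N : NInnerProduct n V) {a : Fin n → V} (ha : LinearIndependent ℝ a) :
    exteriorPower.ιMulti ℝ n a ≠ 0 := by
  intro h
  have := N.pos a ha
  rw [← bilin_ιMulti, h] at this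
  simp at this

/-- The metric on the Grassmannian: the angle between the lines in the exterior power. -/
noncomputable abbrev grassmannMetric (hV : (n : Cardinal) ≤ Module.rank ℝ V) :
    MetricSpace (Grassmann n V) :=
  letI := (N.innerCore hV).toNormedAddCommGroup
  letI := InnerProductSpace.ofCore (N.innerCore hV).toCore
  { dist := fun S T => lineAngle (exteriorPower.ιMulti ℝ n S.frame.1)
      (exteriorPower.ιMulti ℝ n T.frame.1)
    dist_self := fun S => lineAngle_self (N.ιMulti_ne_zero S.frame.2)
    dist_comm := fun S T => lineAngle_comm _ _
    dist_triangle := fun S T U => lineAngle_triangle _ _ _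
    eq_of_dist_eq_zero := fun {S T} h => by
      obtain ⟨r, hr⟩ := exists_smul_eq_of_lineAngle_eq_zero h
      have hle := span_le_span_of_ιMulti_eq_smul (N.ιMulti_ne_zero T.frame.2) hr
      have : Grassmann.ofFrame S.frame = Grassmann.ofFrame T.frame := Grassmann.ofFrame_eq_of_span_le hle
      rwa [S.ofFrame_frame, T.ofFrame_frame] at this }

theorem dist_eq (hV : (n : Cardinal) ≤ Module.rank ℝ V) (S T : Grassmann n V) {a b : Fin n → V}
    (ha : LinearIndependent ℝ a) (haS : ∀ i, a i ∈ S.toSubmodule)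
    (hb : LinearIndependent ℝ b) (hbT : ∀ i, b i ∈ T.toSubmodule) :
    (N.grassmannMetric hV).dist S T = Real.arccos (|N a b| / (N.nnorm a * N.nnorm b)) := by
  rw [← N.abs_div_nnorm_congr S T ha haS S.frame.2 S.frame_mem hb hbT T.frame.2 T.frame_mem]
  simp only [nnorm, ← bilin_ιMulti]
  rfl

end NInnerProduct

/-! ### Comparison with the usual topology. -/

theorem MultilinearMap.continuous_of_isModuleTopology {κ W : Type*} [Finite κ] [AddCommGroup W]
    [Module ℝ W] [FiniteDimensional ℝ W] [TopologicalSpace W] [IsModuleTopology ℝ W]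
    (f : MultilinearMap ℝ (fun _ : κ => W) ℝ) : Continuous f := by
  classical
  have := Fintype.ofFinite κ
  set e := Module.finBasis ℝ W
  have hf : ⇑f = fun a => ∑ I : κ → Fin (Module.finrank ℝ W),
      (∏ i, e.coord (I i) (a i)) * f (fun i => e (I i)) := by
    funext a
    have ha : a = fun i => ∑ k, e.coord k (a i) • e k := by
      funext i
      exact (e.sum_repr (a i)).symm
    conv_lhs => rw [ha, f.map_sum]
    refine Finset.sum_congr rfl fun I _ => ?_
    rw [f.map_smul_univ, smul_eq_mul]
  rw [hf]
  have hc (k) : Continuous (e.coord k) := IsModuleTopology.continuous_of_linearMap _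
  fun_prop

theorem isCompact_setOf_orthonormal (κ E : Type*) [Finite κ] [NormedAddCommGroup E]
    [InnerProductSpace ℝ E] [FiniteDimensional ℝ E] :
    IsCompact {v : κ → E | Orthonormal ℝ v} := by
  classical
  have := FiniteDimensional.proper ℝ E
  refine (isCompact_univ_pi fun _ : κ => isCompact_sphere (0 : E) 1).of_isClosed_subset ?_ ?_
  · simp only [orthonormal_iff_ite, Set.ofPred_forall]
    refine isClosed_iInter fun i => isClosed_iInter fun j => isClosed_eq ?_ continuous_const
    fun_prop
  · intro v hv i _
    simp [hv.1 i]

namespace Grassmann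

variable {n : ℕ} [NeZero n] {W : Type*} [AddCommGroup W] [Module ℝ W] [FiniteDimensional ℝ W]

/-- The orthonormal frames of a Euclidean model of W form a compact set that maps continuously onto
the Grassmannian. -/
theorem compactSpace_usualTopology : @CompactSpace (Grassmann n W) (usualTopology n W) := by
  let : TopologicalSpace W := moduleTopology ℝ W
  have : IsModuleTopology ℝ W := ⟨rfl⟩
  have : IsTopologicalAddGroup W := IsModuleTopology.topologicalAddGroup ℝ W
  let : TopologicalSpace (Grassmann n W) := usualTopology n W
  set E := EuclideanSpace ℝ (Fin (Module.finrank ℝ W))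
  set ψ : E ≃ₗ[ℝ] W := LinearEquiv.ofFinrankEq _ _ (by simp [E])
  have hψ : Continuous ψ := ψ.toLinearMap.continuous_of_finiteDimensional
  have : CompactSpace {v : Fin n → E | Orthonormal ℝ v} :=
    isCompact_iff_compactSpace.1 (isCompact_setOf_orthonormal (Fin n) E)
  have hli (v : {v : Fin n → E | Orthonormal ℝ v}) : LinearIndependent ℝ fun i => ψ (v.1 i) :=
    v.2.linearIndependent.map' ψ.toLinearMap ψ.ker
  let q : {v : Fin n → E | Orthonormal ℝ v} → Grassmann n W :=
    fun v => ofFrame ⟨fun i => ψ (v.1 i), hli v⟩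
  have hqc : Continuous q := by
    have hof : Continuous (ofFrame : {a : Fin n → W // LinearIndependent ℝ a} → Grassmann n W) :=
      continuous_coinduced_rng
    have hψv : Continuous fun v : {v : Fin n → E | Orthonormal ℝ v} => fun i => ψ (v.1 i) :=
      continuous_pi fun i => hψ.comp ((continuous_apply i).comp continuous_subtype_val)
    exact hof.comp (hψv.subtype_mk hli)
  have hqs : Function.Surjective q := by
    intro S
    have hrank : Module.finrank ℝ (S.toSubmodule.map ψ.symm.toLinearMap) = n :=
      (LinearEquiv.finrank_map_eq ψ.symm S.toSubmodule).trans S.finrank_eq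
    set o := (stdOrthonormalBasis ℝ (S.toSubmodule.map ψ.symm.toLinearMap)).reindex
      (finCongr hrank)
    refine ⟨⟨fun i => (o i : E), ?_⟩, ?_⟩
    · exact o.orthonormal.comp_linearIsometry (S.toSubmodule.map ψ.symm.toLinearMap).subtypeₗᵢ
    · refine ofFrame_eq S _ fun i => ?_
      obtain ⟨w, hw, hwi⟩ := (o i).2
      change ψ (o i : E) ∈ S.toSubmodule
      rw [← hwi]
      simpa using hw
  exact hqs.compactSpace hqc

end Grassmann

namespace NInnerProduct

variable {n : ℕ} [NeZero n] {V : Type*} [AddCommGroup V] [Module ℝ V] (N : NInnerProduct n V)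

theorem continuous_apply_self {W : Type*} [AddCommGroup W] [Module ℝ W] [FiniteDimensional ℝ W]
    [TopologicalSpace W] [IsModuleTopology ℝ W] (j : W →ₗ[ℝ] V) :
    Continuous fun a : Fin n → W => N (j ∘ a) (j ∘ a) := by
  have h1 (b : Fin n → V) : Continuous fun a : Fin n → W => N (j ∘ a) b :=
    ((N.form b).compLinearMap j).toMultilinearMap.continuous_of_isModuleTopology
  set e := Module.finBasis ℝ W
  -- Expanding only one argument in a basis reduces the claim to products of coordinates and
  -- functions multilinear in a.
  have hf : (fun a : Fin n → W => N (j ∘ a) (j ∘ a)) =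
      fun a => ∑ I : Fin n → Fin (Module.finrank ℝ W),
        (∏ i, e.coord (I i) (a i)) * N (j ∘ a) (j ∘ e ∘ I) := by
    funext a
    have ha : a = fun i => ∑ k, e.coord k (a i) • e k := by
      funext i
      exact (e.sum_repr (a i)).symm
    set f := ((N.form (j ∘ a)).compLinearMap j).toMultilinearMap
    change f a = _
    conv_lhs => rw [ha, f.map_sum]
    refine Finset.sum_congr rfl fun I _ => ?_
    rw [f.map_smul_univ, smul_eq_mul, N.symm (j ∘ a)]
    rfl
  rw [hf]
  have hc (k) : Continuous (e.coord k) := IsModuleTopology.continuous_of_linearMap _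
  fun_prop

/-- A continuous injection from a compact space to a Hausdorff space is a closed embedding. General
j and G cover both the identity and the inclusion of a subspace. -/
theorem induced_grassmannMetric (hV : (n : Cardinal) ≤ Module.rank ℝ V) {W : Type*}
    [AddCommGroup W] [Module ℝ W] [FiniteDimensional ℝ W] (j : W →ₗ[ℝ] V)
    (hj : Function.Injective j) (G : Grassmann n W → Grassmann n V)
    (hG : ∀ S, (G S).toSubmodule = S.toSubmodule.map j) :
    TopologicalSpace.induced G (N.grassmannMetric hV).toUniformSpace.toTopologicalSpace =
      Grassmann.usualTopology n W := by
  let : TopologicalSpace W := moduleTopology ℝ W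
  have : IsModuleTopology ℝ W := ⟨rfl⟩
  let : TopologicalSpace (Grassmann n W) := Grassmann.usualTopology n W
  have : CompactSpace (Grassmann n W) := Grassmann.compactSpace_usualTopology
  let : MetricSpace (Grassmann n V) := N.grassmannMetric hV
  have hGinj : Function.Injective G := by
    intro S T h
    ext1
    exact Submodule.map_injective_of_injective hj (by rw [← hG, h, hG])
  have hGcont : Continuous G := by
    -- Continuity on the quotient is tested on frames, where the distance to a fixed point is given
    -- by the arccos formula.
    refine continuous_coinduced_dom.2 (continuous_iff_continuousAt.2 fun a₀ => ?_)
    have hli (a : {a : Fin n → W // LinearIndependent ℝ a}) : LinearIndependent ℝ (j ∘ a.1) :=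
      a.2.map' j (LinearMap.ker_eq_bot.2 hj)
    have hmem (a : {a : Fin n → W // LinearIndependent ℝ a}) (i : Fin n) :
        (j ∘ a.1) i ∈ (G (Grassmann.ofFrame a)).toSubmodule := by
      rw [hG]
      exact Submodule.mem_map_of_mem (Submodule.subset_span (Set.mem_range_self i))
    have hpos (a : {a : Fin n → W // LinearIndependent ℝ a}) : 0 < N.nnorm (j ∘ a.1) :=
      Real.sqrt_pos.2 (N.pos _ (hli a))
    rw [ContinuousAt, tendsto_iff_dist_tendsto_zero]
    have hdist (a : {a : Fin n → W // LinearIndependent ℝ a}) :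
        dist (G (Grassmann.ofFrame a)) (G (Grassmann.ofFrame a₀)) =
          Real.arccos (|N (j ∘ a.1) (j ∘ a₀.1)| / (N.nnorm (j ∘ a.1) * N.nnorm (j ∘ a₀.1))) :=
      N.dist_eq hV _ _ (hli a) (hmem a) (hli a₀) (hmem a₀)
    have hcont : Continuous fun a : {a : Fin n → W // LinearIndependent ℝ a} =>
        dist (G (Grassmann.ofFrame a)) (G (Grassmann.ofFrame a₀)) := by
      simp only [hdist]
      have h1 : Continuous fun a : Fin n → W => N (j ∘ a) (j ∘ a₀.1) :=
        ((N.form _).compLinearMap j).toMultilinearMap.continuous_of_isModuleTopology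
      have h2 := N.continuous_apply_self j
      refine Real.continuous_arccos.comp (Continuous.div ?_ ?_ ?_)
      · exact (h1.comp continuous_subtype_val).abs
      · exact (h2.comp continuous_subtype_val).sqrt.mul continuous_const
      · exact fun a => (mul_pos (hpos a) (hpos a₀)).ne'
    simpa using hcont.tendsto a₀
  exact (hGcont.isClosedEmbedding hGinj).isInducing.eq_induced.symm

end NInnerProduct

theorem mainTheorem3 {n : ℕ} [NeZero n] {V : Type*} [AddCommGroup V] [Module ℝ V]
    (hV : (n : Cardinal) ≤ Module.rank ℝ V) (N : NInnerProduct n V) :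
    (∃ C : InnerProductSpace.Core ℝ (⋀[ℝ]^n V),
      (∀ a b : Fin n → V,
        C.inner (exteriorPower.ιMulti ℝ n a) (exteriorPower.ιMulti ℝ n b) = N a b) ∧
      ∀ (ι : Type*) (e : Module.Basis ι ℝ V),
        N.IsExtensionFromBasis e C.inner ∧
        ∀ f : ⋀[ℝ]^n V → ⋀[ℝ]^n V → ℝ, N.IsExtensionFromBasis e f → f = C.inner) ∧
    ∃ M : MetricSpace (Grassmann n V),
      (∀ (S T : Grassmann n V) (a b : Fin n → V),
        LinearIndependent ℝ a → (∀ i, a i ∈ S.toSubmodule) →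
        LinearIndependent ℝ b → (∀ i, b i ∈ T.toSubmodule) →
        M.dist S T = Real.arccos (|N a b| / (N.nnorm a * N.nnorm b))) ∧
      (FiniteDimensional ℝ V →
        M.toUniformSpace.toTopologicalSpace = Grassmann.usualTopology n V) ∧
      ∀ W : Submodule ℝ V, FiniteDimensional ℝ W →
        TopologicalSpace.induced (Grassmann.ofSubspace W) M.toUniformSpace.toTopologicalSpace =
          Grassmann.usualTopology n W := by
  refine ⟨⟨N.innerCore hV, N.bilin_ιMulti, fun ι e => ⟨N.isExtensionFromBasis_bilin e,
    fun f hf => hf.eq N (N.isExtensionFromBasis_bilin e)⟩⟩,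
    N.grassmannMetric hV, fun S T a b ha haS hb hbT => N.dist_eq hV S T ha haS hb hbT, ?_, ?_⟩
  · intro _
    exact (@induced_id _ (N.grassmannMetric hV).toUniformSpace.toTopologicalSpace).symm.trans
      (N.induced_grassmannMetric hV LinearMap.id Function.injective_id id (by simp))
  · intro W _
    exact N.induced_grassmannMetric hV W.subtype W.injective_subtype _ fun S => rfl
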